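/- **Theorem (converse bound under uncoded placement).** *Model.* Let $\mathbb F_q$ be a finite field, $N,K$ numbers of files and users, $0\le M\le N$ a cache size, and $\mathbf p=(p_1,\dots,p_N)$ a probability vector. For every file size $F$ the server holds files $W_1,\dots,W_N$ that are independent and uniformly distributed on $\mathbb F_q^F$; $H_q$ denotes entropy in base $q$. An uncoded placement strategy consists, for every $F$, of sets $A_{k,n}\subseteq[F]$ ($k\in[K]$, $n\in[N]$); user $k$ stores $Z_k=(W_1|_{A_{k,1}},\dots,W_N|_{A_{k,N}})$, where $W_n|_A$ is the family of symbols of $W_n$ indexed by $A$, and $H_q(Z_k)\le MF$ is required for all $k$. For a request vector $\mathbf d\in[N]^K$ (user $k$ requests file $W_{d_k}$), a rate $R_{\mathbf d,F}\in\mathbb R$ is achievable for the given placement if there are a discrete random variable $X$ (the delivery message) with $H_q(X)\le R_{\mathbf d,F}\,F$ and functions $g_1,\dots,g_K$ with $\mathbb P(g_k(X,Z_k)\ne W_{d_k})=0$ for all $k\in[K]$. An expected delivery rate $\bar R\in\mathbb R$ is achievable under uncoded placement if for some uncoded placement strategy there are achievable rates $R_{\mathbf d,F}$ ($\mathbf d\in[N]^K$,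 $F\in\mathbb N$) with $$\limsup_{F\to\infty}\ \sum_{\mathbf d\in[N]^K}\Big(\prod_{k=1}^K p_{d_k}\Big)R_{\mathbf d,F}\ \le\ \bar R .$$ *Claim.* Every expected delivery rate $\bar R$ that is achievable under uncoded placement satisfies $$\bar R\ \ge\ \min_{\substack{\mathbf t\in\mathbb R^N\\ \sum_n t_n=MK,\ 0\le t_n\le K}}\ \sum_{\mathcal N\subseteq[N]}\ \sum_{\substack{\mathbf d\in[N]^K\\ \mathrm{Range}(\mathbf d)=\mathcal N}}\Big(\prod_{k=1}^K p_{d_k}\Big)\ \max_{\pi}\,R_\pi(\mathbf t,\mathcal N),$$ where $\mathrm{Range}(\mathbf d)=\{d_1,\dots,d_K\}$, the maximum is over all bijections $\pi:[|\mathcal N|]\to\mathcal N$, and $$R_\pi(\mathbf t,\mathcal N)=\sum_{i=1}^{|\mathcal N|}\left[\big(1-t_{\pi(i)}+\lfloor t_{\pi(i)}\rfloor\big)\frac{\binom{K-i}{\lfloor t_{\pi(i)}\rfloor}}{\binom{K}{\lfloor t_{\pi(i)}\rfloor}}+\big(t_{\pi(i)}-\lfloor t_{\pi(i)}\rfloor\big)\frac{\binom{K-i}{\lfloor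 t_{\pi(i)}\rfloor+1}}{\binom{K}{\lfloor t_{\pi(i)}\rfloor+1}}\right],$$ with $\binom ab=0$ for $b>a$ and the second summand read as $0$ when $t_{\pi(i)}=K$. In particular the minimum is attained. -/

import Mathlib

open MeasureTheory ProbabilityTheory Filter
open scoped ENNReal

noncomputable section

namespace CodedCaching

/-- The base-`q` entropy `H_q(X) = - ∑ x, P(X = x) log_q P(X = x)` of a discrete random variable,
as an element of `[0, ∞]`. All summands are nonnegative when `μ` is a probability and `q ≥ 2`. -/
def entropy {Ω : Type*} [MeasurableSpace Ω] (μ : Measure Ω) (q : ℕ) {𝒳 : Type*} (X : Ω → 𝒳) :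
    ℝ≥0∞ :=
  ∑' x : 𝒳, ENNReal.ofReal
    (-(μ.real (X ⁻¹' {x}) * Real.logb (q : ℝ) (μ.real (X ⁻¹' {x}))))

/-- A file consisting of `F` symbols over the alphabet `𝔽`. -/
abbrev File (𝔽 : Type*) (F : ℕ) : Type _ := Fin F → 𝔽

/-- The server's library: for every file size `F`, the `N` files `W F 0, …, W F (N - 1)` are
independent and each of them is uniformly distributed over the words of `F` symbols. -/
structure IsUniformLibrary {Ω 𝔽 : Type*} [MeasurableSpace Ω] [Fintype 𝔽] [MeasurableSpace 𝔽]
    {N : ℕ} (μ : Measure Ω) (W : (F : ℕ) → Fin N → Ω → File 𝔽 F) : Prop where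
  measurable : ∀ F n, Measurable (W F n)
  indep : ∀ F, iIndepFun (W F) μ
  uniform : ∀ F n, μ.map (W F n) = uniformOn (Set.univ : Set (File 𝔽 F))

/-- An uncoded placement for files of `F` symbols: `A k n` is the set of the indices of those
symbols of file `n` that user `k` stores. -/
abbrev Placement (N K F : ℕ) : Type := Fin K → Fin N → Finset (Fin F)

/-- The cache content `Z_k = (W_1|_{A k 1}, …, W_N|_{A k N})` of user `k`. -/
def cacheContent {Ω 𝔽 : Type*} {N K F : ℕ} (W : Fin N → Ω → File 𝔽 F) (A : Placement N K F)
    (k : Fin K) (ω : Ω) : (n : Fin N) → A k n → 𝔽 :=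
  fun n j => W n ω j

/-- The memory constraint `H_q(Z_k) ≤ M F` for every user `k`. -/
def FitsMemory {Ω 𝔽 : Type*} [MeasurableSpace Ω] [Fintype 𝔽] {N K F : ℕ} (μ : Measure Ω)
    (W : Fin N → Ω → File 𝔽 F) (A : Placement N K F) (M : ℝ) : Prop :=
  ∀ k, (entropy μ (Fintype.card 𝔽) (cacheContent W A k) : EReal) ≤ ((M * F : ℝ) : EReal)

/-- For fixed placement, file size and request vector `d`, the delivery rate `R` is achievable:
there are a discrete random delivery message `X` with `H_q(X) ≤ R F` and decoding functions `g k`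
with which every user `k` recovers the file `d k` from `X` and from his cache with error
probability zero. -/
def DeliveryRateAchievable {Ω 𝔽 : Type*} [MeasurableSpace Ω] [Fintype 𝔽] {N K F : ℕ}
    (μ : Measure Ω) (W : Fin N → Ω → File 𝔽 F) (A : Placement N K F) (d : Fin K → Fin N)
    (R : ℝ) : Prop :=
  ∃ (X : Ω → ℕ) (g : (k : Fin K) → ℕ → ((n : Fin N) → A k n → 𝔽) → File 𝔽 F),
    Measurable X ∧
    (∀ k, μ {ω | g k (X ω) (cacheContent W A k ω) ≠ W (d k) ω} = 0) ∧
    (entropy μ (Fintype.card 𝔽) X : EReal) ≤ ((R * F : ℝ) : EReal)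

/-- The expectation of `R d` over a request vector `d` with i.i.d. entries of law `p`. -/
def expectedRate {N K : ℕ} (p : Fin N → ℝ) (R : (Fin K → Fin N) → ℝ) : ℝ :=
  ∑ d : Fin K → Fin N, (∏ k, p (d k)) * R d

/-- For a fixed placement strategy (one placement for each file size), the expected delivery rate
`Rbar` is achievable: some achievable delivery rates `R F d` satisfy
`limsup_{F → ∞} E_d (R F d) ≤ Rbar`. -/
def ExpectedRateAchievableFor {Ω 𝔽 : Type*} [MeasurableSpace Ω] [Fintype 𝔽] {N K : ℕ}
    (μ : Measure Ω) (W : (F : ℕ) → Fin N → Ω → File 𝔽 F) (p : Fin N → ℝ)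
    (A : (F : ℕ) → Placement N K F) (Rbar : ℝ) : Prop :=
  ∃ R : ℕ → (Fin K → Fin N) → ℝ,
    (∀ F d, DeliveryRateAchievable μ (W F) (A F) d (R F d)) ∧
    limsup (fun F : ℕ => ((expectedRate p (R F) : ℝ) : EReal)) atTop ≤ (Rbar : EReal)

/-- With `K` users of cache size `M`, the expected delivery rate `Rbar` is achievable under
uncoded placement. -/
def ExpectedRateAchievable {Ω 𝔽 : Type*} [MeasurableSpace Ω] [Fintype 𝔽] {N : ℕ}
    (μ : Measure Ω) (W : (F : ℕ) → Fin N → Ω → File 𝔽 F) (p : Fin N → ℝ) (K : ℕ) (M : ℝ)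
    (Rbar : ℝ) : Prop :=
  ∃ A : (F : ℕ) → Placement N K F, (∀ F, FitsMemory μ (W F) (A F) M) ∧
    ∃ R' ≤ Rbar, ExpectedRateAchievableFor μ W p A R'

/-- The cache allocations `t` with `∑ t_n = M K` and `0 ≤ t_n ≤ K`. -/
def cacheAllocations (N K : ℕ) (M : ℝ) : Set (Fin N → ℝ) :=
  {t | ∑ n, t n = M * K ∧ ∀ n, 0 ≤ t n ∧ t n ≤ K}

/-- The `i`-th summand of the rate of an auxiliary user: the linear interpolation at `x` of the
values `C(K - i, m) / C(K, m)`, `m = 0, …, K`. -/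
def interpolatedRatio (K i : ℕ) (x : ℝ) : ℝ :=
  (1 - x + ⌊x⌋₊) * (((K - i).choose ⌊x⌋₊ : ℝ) / (K.choose ⌊x⌋₊ : ℝ)) +
    (x - ⌊x⌋₊) * (((K - i).choose (⌊x⌋₊ + 1) : ℝ) / (K.choose (⌊x⌋₊ + 1) : ℝ))

/-- The rate `R_π(t, S)` for the ordering `π` of the set `S` of requested files. The positions of
the ordering are numbered from `0` in `Fin S.card`, so that position `i` has rank `i + 1`. -/
def orderingRate {N : ℕ} (K : ℕ) (t : Fin N → ℝ) (S : Finset (Fin N)) (π : Fin S.card ≃ S) : ℝ :=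
  ∑ i : Fin S.card, interpolatedRatio K (i + 1) (t (π i))

/-- The maximum of `R_π(t, S)` over all orderings `π` of `S`. -/
def maxOrderingRate {N : ℕ} (K : ℕ) (t : Fin N → ℝ) (S : Finset (Fin N)) : ℝ :=
  (Finset.univ : Finset (Fin S.card ≃ S)).sup' ⟨S.equivFin.symm, Finset.mem_univ _⟩
    (orderingRate K t S)

/-- The expression that is minimized over the cache allocations `t`; the set `Range(d)` of the
requested files is the image of `d`. -/
def converseBound {N : ℕ} (K : ℕ) (p : Fin N → ℝ) (t : Fin N → ℝ) : ℝ :=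
  ∑ S : Finset (Fin N), ∑ d : Fin K → Fin N with Finset.univ.image d = S,
    (∏ k, p (d k)) * maxOrderingRate K t S

end CodedCaching

end

/-!
The entropy bounds come from a counting argument. If every value of a discrete random variable
`Y` confines the uniformly distributed library to a set of words that are determined by their
symbols outside a set `B`, then no value has probability above `q ^ (-|B|)`, so `H_q(Y) ≥ |B|`
(`card_le_entropy_of_determined`). For a cache content, `B` consists of the stored symbols; hence
the memory constraint bounds the number of stored symbols, and the normalized numbers of cached
copies `t_n` of the files (`allocation`) satisfy `∑ t_n ≤ M K`. For a delivery message, users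
`u 0, u 1, …` that request distinct files `f 0, f 1, …` decode one after the other, and `B`
consists of the symbols of the files `f i` that none of `u 0, …, u i` stores
(`sum_card_uncached_le_of_deliveryRateAchievable`).

As the law of the request vector is invariant under permutations of the users, the second bound
can be averaged over all of them. A symbol stored by `m` users is missed by `i` random users with
probability `C(K - i, m) / C(K, m)` (`card_perm_avoiding_mul_choose`). This ratio is convex and
nonincreasing in `m`, being equal to `C(K - m, i) / C(K, i)`; by Jensen's inequality the average
over the symbols of file `n` is at least the interpolated ratio at `t_n`. So for every file size
`F > 0` the expected rate is at least `converseBound K p t`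
(`converseBound_allocation_le_expectedRate`).

Finally `converseBound` is nonincreasing in `t`, so `t` may be enlarged until `∑ t_n = M K`, and it
is continuous on the compact set of cache allocations, so the minimum is attained. It bounds the
expected rate for each `F > 0`, hence also the limit superior.
-/

namespace CodedCaching

open Finset

/-! ### Entropy of decodable messages -/

/-- If no value has probability above `q ^ (-L)`, the entropy is at least `L`. -/
theorem natCast_le_entropy {Ω 𝒳 : Type*} [MeasurableSpace Ω] [Countable 𝒳] (μ : Measure Ω)
    [IsProbabilityMeasure μ] {q : ℕ} (hq : 1 < q) (X : Ω → 𝒳) (L : ℕ)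
    (h : ∀ x, μ.real (X ⁻¹' {x}) ≤ ((q : ℝ) ^ L)⁻¹) : (L : ℝ≥0∞) ≤ entropy μ q X := by
  have hq' : (1 : ℝ) < q := by exact_mod_cast hq
  have hterm : ∀ x, (L : ℝ≥0∞) * μ (X ⁻¹' {x}) ≤ ENNReal.ofReal
      (-(μ.real (X ⁻¹' {x}) * Real.logb (q : ℝ) (μ.real (X ⁻¹' {x})))) := by
    intro x
    rw [← ofReal_measureReal (μ := μ) (s := X ⁻¹' {x}), ← ENNReal.ofReal_natCast,
      ← ENNReal.ofReal_mul (Nat.cast_nonneg L)]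
    apply ENNReal.ofReal_le_ofReal
    rcases (measureReal_nonneg (μ := μ) (s := X ⁻¹' {x})).eq_or_lt with h0 | h0
    · simp [← h0]
    · have hlog : Real.logb q (μ.real (X ⁻¹' {x})) ≤ -L := by
        calc _ ≤ Real.logb q (((q : ℝ) ^ L)⁻¹) := Real.logb_le_logb_of_le hq' h0 (h x)
          _ = -L := by
            rw [Real.logb_inv, Real.logb_pow, Real.logb_self_eq_one hq', mul_one]
      nlinarith
  have hone : (1 : ℝ≥0∞) ≤ ∑' x, μ (X ⁻¹' {x}) := by
    rw [← measure_univ (μ := μ)]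
    refine (measure_mono fun ω _ => ?_).trans (measure_iUnion_le fun x => X ⁻¹' {x})
    exact Set.mem_iUnion.2 ⟨X ω, rfl⟩
  calc (L : ℝ≥0∞) = L * 1 := (mul_one _).symm
    _ ≤ L * ∑' x, μ (X ⁻¹' {x}) := by gcongr
    _ = ∑' x, L * μ (X ⁻¹' {x}) := ENNReal.tsum_mul_left.symm
    _ ≤ _ := ENNReal.tsum_le_tsum hterm

theorem natCast_le_of_le_of_coe_le {L : ℕ} {e : ℝ≥0∞} {r : ℝ} (hL : (L : ℝ≥0∞) ≤ e)
    (he : (e : EReal) ≤ (r : EReal)) : (L : ℝ) ≤ r := by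
  have h := (EReal.coe_ennreal_le_coe_ennreal_iff.2 hL).trans he
  rw [← ENNReal.ofReal_natCast, EReal.coe_ennreal_ofReal, max_eq_left (Nat.cast_nonneg L)] at h
  exact EReal.coe_le_coe_iff.1 h

theorem measure_library_mem_le {Ω 𝔽 : Type*} [MeasurableSpace Ω] [Fintype 𝔽] [MeasurableSpace 𝔽]
    [MeasurableSingletonClass 𝔽] {N F : ℕ} (μ : Measure Ω) {W : (F : ℕ) → Fin N → Ω → File 𝔽 F}
    (hW : IsUniformLibrary μ W) (T : Finset (Fin N → File 𝔽 F)) :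
    μ {ω | (fun n => W F n ω) ∈ T} ≤ T.card * ((Fintype.card 𝔽 : ℝ≥0∞) ^ (N * F))⁻¹ := by
  have hpoint : ∀ w : Fin N → File 𝔽 F,
      μ {ω | (fun n => W F n ω) = w} = ((Fintype.card 𝔽 : ℝ≥0∞) ^ (N * F))⁻¹ := by
    intro w
    have hset : {ω | (fun n => W F n ω) = w} = ⋂ n ∈ (univ : Finset (Fin N)), W F n ⁻¹' {w n} := by
      ext ω
      simp [funext_iff]
    rw [hset, (hW.indep F).measure_inter_preimage_eq_mul univ
      (sets := fun n => {w n}) fun n _ => measurableSet_singleton _]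
    have hn : ∀ n, μ (W F n ⁻¹' {w n}) = ((Fintype.card 𝔽 : ℝ≥0∞) ^ F)⁻¹ := by
      intro n
      rw [← Measure.map_apply (hW.measurable F n) (measurableSet_singleton _), hW.uniform F n,
        uniformOn_univ, Measure.count_singleton]
      simp
    simp_rw [hn]
    rw [prod_const, card_univ, Fintype.card_fin, ← ENNReal.inv_pow, ← pow_mul, mul_comm F N]
  have hset : {ω | (fun n => W F n ω) ∈ T} = ⋃ w ∈ T, {ω | (fun n => W F n ω) = w} := by
    ext ω
    simp
  rw [hset]
  refine (measure_biUnion_finset_le T _).trans ?_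
  simp [hpoint]

/-- A set of words on which the symbols outside `B` determine the word has at most
`q ^ (N F - |B|)` elements. -/
theorem card_mul_pow_le {𝔽 : Type*} [Fintype 𝔽] {N F : ℕ} (T : Finset (Fin N → File 𝔽 F))
    (B : Finset (Fin N × Fin F))
    (hT : ∀ w ∈ T, ∀ w' ∈ T, (∀ n j, (n, j) ∉ B → w n j = w' n j) → w = w') :
    T.card * Fintype.card 𝔽 ^ B.card ≤ Fintype.card 𝔽 ^ (N * F) := by
  classical
  have hinj : Function.Injective
      (fun (w : T) (x : {x : Fin N × Fin F // x ∉ B}) => w.1 x.1.1 x.1.2) := by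
    intro w w' h
    exact Subtype.ext (hT w w.2 w' w'.2 fun n j hnj => congrFun h ⟨(n, j), hnj⟩)
  have hcard := Fintype.card_le_of_injective _ hinj
  rw [Fintype.card_coe, Fintype.card_fun, Fintype.card_subtype_compl, Fintype.card_prod,
    Fintype.card_fin, Fintype.card_fin, Fintype.card_coe] at hcard
  have hB : B.card ≤ N * F := by
    simpa using card_le_univ B
  calc _ ≤ Fintype.card 𝔽 ^ (N * F - B.card) * Fintype.card 𝔽 ^ B.card := by gcongr
    _ = _ := by rw [← pow_add, Nat.sub_add_cancel hB]

/-- If every value `y` of `Y` confines the library to a set `T y` of words that are determined by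
their symbols outside `B`, then every value of `Y` has probability at most `q ^ (-|B|)`, and
hence `H_q(Y) ≥ |B|`. -/
theorem card_le_entropy_of_determined {Ω 𝔽 𝒳 : Type*} [MeasurableSpace Ω] [Fintype 𝔽]
    [Nontrivial 𝔽] [MeasurableSpace 𝔽] [MeasurableSingletonClass 𝔽] [Countable 𝒳] {N F : ℕ}
    (μ : Measure Ω) [IsProbabilityMeasure μ] {W : (F : ℕ) → Fin N → Ω → File 𝔽 F}
    (hW : IsUniformLibrary μ W) (Y : Ω → 𝒳) (T : 𝒳 → Set (Fin N → File 𝔽 F))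
    (hYT : ∀ᵐ ω ∂μ, (fun n => W F n ω) ∈ T (Y ω)) (B : Finset (Fin N × Fin F))
    (hT : ∀ y, ∀ w ∈ T y, ∀ w' ∈ T y, (∀ n j, (n, j) ∉ B → w n j = w' n j) → w = w') :
    (B.card : ℝ≥0∞) ≤ entropy μ (Fintype.card 𝔽) Y := by
  classical
  refine natCast_le_entropy μ Fintype.one_lt_card Y B.card fun y => ?_
  have hq : 0 < Fintype.card 𝔽 := Fintype.card_pos
  have hμ : μ (Y ⁻¹' {y}) ≤ (T y).toFinset.card * ((Fintype.card 𝔽 : ℝ≥0∞) ^ (N * F))⁻¹ := by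
    refine (measure_mono_ae ?_).trans (measure_library_mem_le μ hW (T y).toFinset)
    filter_upwards [hYT] with ω hω hy
    have hy' : Y ω = y := hy
    rw [hy'] at hω
    exact Set.mem_toFinset.2 hω
  have hcard := card_mul_pow_le (T y).toFinset B
    (by simpa only [Set.mem_toFinset] using hT y)
  have hreal : μ.real (Y ⁻¹' {y}) ≤
      (T y).toFinset.card * ((Fintype.card 𝔽 : ℝ) ^ (N * F))⁻¹ := by
    have h := ENNReal.toReal_mono (by finiteness) hμ
    simpa [measureReal_def] using h
  have hq' : (0 : ℝ) < Fintype.card 𝔽 := by exact_mod_cast hq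
  have hcard' : ((T y).toFinset.card : ℝ) * (Fintype.card 𝔽 : ℝ) ^ B.card ≤
      (Fintype.card 𝔽 : ℝ) ^ (N * F) := by exact_mod_cast hcard
  refine hreal.trans ?_
  rw [← div_eq_mul_inv, div_le_iff₀ (by positivity), inv_mul_eq_div, le_div_iff₀ (by positivity)]
  exact hcard'

theorem sum_card_le_entropy_cacheContent {Ω 𝔽 : Type*} [MeasurableSpace Ω] [Fintype 𝔽]
    [Nontrivial 𝔽] [MeasurableSpace 𝔽] [MeasurableSingletonClass 𝔽] {N K F : ℕ}
    (μ : Measure Ω) [IsProbabilityMeasure μ] {W : (F : ℕ) → Fin N → Ω → File 𝔽 F}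
    (hW : IsUniformLibrary μ W) (A : Placement N K F) (k : Fin K) :
    ((∑ n, (A k n).card : ℕ) : ℝ≥0∞) ≤
      entropy μ (Fintype.card 𝔽) (cacheContent (W F) A k) := by
  classical
  have h := card_le_entropy_of_determined (F := F) μ hW (cacheContent (W F) A k)
    (fun z => {w | ∀ n (j : A k n), w n j = z n j})
    (ae_of_all μ fun ω n j => rfl)
    (univ.filter fun x : Fin N × Fin F => x.2 ∈ A k x.1) ?_
  · convert h
    rw [card_filter, Fintype.sum_prod_type]
    simp
  · intro z w hw w' hw' hww'
    funext n j
    by_cases hj : j ∈ A k n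
    · exact (hw n ⟨j, hj⟩).trans (hw' n ⟨j, hj⟩).symm
    · exact hww' n j (by simpa using hj)

/-- The cut-set bound: ordered users `u 0, u 1, …` that request distinct files `f 0, f 1, …`
decode successively, so the message carries all symbols of `f i` that none of
`u 0, …, u i` has stored. -/
theorem sum_card_uncached_le_of_deliveryRateAchievable {Ω 𝔽 : Type*} [MeasurableSpace Ω]
    [Fintype 𝔽] [Nontrivial 𝔽] [MeasurableSpace 𝔽] [MeasurableSingletonClass 𝔽] {N K F s : ℕ}
    (μ : Measure Ω) [IsProbabilityMeasure μ] {W : (F : ℕ) → Fin N → Ω → File 𝔽 F}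
    (hW : IsUniformLibrary μ W) (A : Placement N K F) (d : Fin K → Fin N) (R : ℝ)
    (hR : DeliveryRateAchievable μ (W F) A d R) (f : Fin s → Fin N) (hf : f.Injective)
    (u : Fin s → Fin K) (hu : ∀ i, d (u i) = f i) :
    ((∑ i, #{j : Fin F | ∀ i' ≤ i, j ∉ A (u i') (f i)} : ℕ) : ℝ) ≤ R * F := by
  classical
  obtain ⟨X, g, -, hg, hH⟩ := hR
  set B : Finset (Fin N × Fin F) :=
    univ.biUnion fun i => (univ.filter fun j => ∀ i' ≤ i, j ∉ A (u i') (f i)).image (Prod.mk (f i))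
    with hB
  have hmem : ∀ n j, (n, j) ∈ B ↔ ∃ i, f i = n ∧ ∀ i' ≤ i, j ∉ A (u i') n := by
    intro n j
    simp only [hB, mem_biUnion, mem_univ, true_and, mem_image, mem_filter, Prod.mk.injEq]
    constructor
    · rintro ⟨i, j', hj', rfl, rfl⟩
      exact ⟨i, rfl, hj'⟩
    · rintro ⟨i, rfl, hj⟩
      exact ⟨i, j, hj, rfl, rfl⟩
  have hcard : B.card = ∑ i, #{j : Fin F | ∀ i' ≤ i, j ∉ A (u i') (f i)} := by
    rw [hB, card_biUnion]
    · exact sum_congr rfl fun i _ => card_image_of_injective _ (Prod.mk_right_injective _)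
    · intro i _ i' _ hii'
      refine disjoint_left.2 fun x hx hx' => ?_
      obtain ⟨j, -, rfl⟩ := mem_image.1 hx
      obtain ⟨j', -, hj'⟩ := mem_image.1 hx'
      exact hii' (hf (congrArg Prod.fst hj').symm)
  have h := card_le_entropy_of_determined (F := F) μ hW X
    (fun x => {w | ∀ k, g k x (fun n j => w n j) = w (d k)}) ?_ B ?_
  · rw [← hcard]
    exact natCast_le_of_le_of_coe_le h hH
  · have hall : ∀ᵐ ω ∂μ, ∀ k, g k (X ω) (cacheContent (W F) A k ω) = W F (d k) ω :=
      ae_all_iff.2 fun k => hg k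
    exact hall
  · intro x w hw w' hw' hww'
    have hfile : ∀ i, w (f i) = w' (f i) := by
      intro i
      induction i using WellFoundedLT.induction with
      | ind i ih =>
        rw [← hu i, ← hw (u i), ← hw' (u i)]
        congr 1
        funext n j
        by_cases hnj : (n, (j : Fin F)) ∈ B
        · obtain ⟨i₀, rfl, hi₀⟩ := (hmem n j).1 hnj
          exact congrFun (ih i₀ (not_le.1 fun hle => hi₀ i hle j.2)) j
        · exact hww' n j hnj
    funext n j
    by_cases hnj : (n, j) ∈ B
    · obtain ⟨i, rfl, -⟩ := (hmem n j).1 hnj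
      exact congrFun (hfile i) j
    · exact hww' n j hnj

/-! ### Random permutations of the users -/

/-- For `m = |C|`, a uniformly random permutation maps the set `U` into the complement of `C` with
probability `C(K - |U|, m) / C(K, m)`. The number of these permutations depends on `C` only
through `m`, so the pairs `(σ, C)` can be counted in two ways. -/
theorem card_perm_avoiding_mul_choose {K : ℕ} (U C : Finset (Fin K)) :
    #{σ : Equiv.Perm (Fin K) | ∀ x ∈ U, σ x ∉ C} * K.choose C.card =
      K.factorial * (K - U.card).choose C.card := by
  classical
  have hinv : ∀ C' ∈ (univ : Finset (Fin K)).powersetCard C.card,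
      #{σ : Equiv.Perm (Fin K) | ∀ x ∈ U, σ x ∉ C'} =
        #{σ : Equiv.Perm (Fin K) | ∀ x ∈ U, σ x ∉ C} := by
    intro C' hC'
    have hcard : C'.card = C.card := (mem_powersetCard.1 hC').2
    let τ : Equiv.Perm (Fin K) := (equivOfCardEq hcard).extendSubtype
    have hτ : ∀ x, τ x ∈ C ↔ x ∈ C' := by
      intro x
      constructor
      · intro hx
        by_contra hx'
        exact (equivOfCardEq hcard).extendSubtype_not_mem x hx' hx
      · exact (equivOfCardEq hcard).extendSubtype_mem x
    refine card_equiv (Equiv.mulLeft τ) fun σ => ?_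
    simp [hτ]
  have hdouble := sum_card_bipartiteAbove_eq_sum_card_bipartiteBelow
    (s := (univ : Finset (Equiv.Perm (Fin K))))
    (t := (univ : Finset (Fin K)).powersetCard C.card)
    (fun σ C' => ∀ x ∈ U, σ x ∉ C')
  have hleft : ∀ σ : Equiv.Perm (Fin K), #(bipartiteAbove (fun (σ : Equiv.Perm (Fin K)) C' =>
      ∀ x ∈ U, σ x ∉ C') (univ.powersetCard C.card) σ) = (K - U.card).choose C.card := by
    intro σ
    have : bipartiteAbove (fun (σ : Equiv.Perm (Fin K)) C' => ∀ x ∈ U, σ x ∉ C')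
        (univ.powersetCard C.card) σ = ((U.map σ.toEmbedding)ᶜ).powersetCard C.card := by
      ext C'
      rw [bipartiteAbove, mem_filter, mem_powersetCard, mem_powersetCard, and_comm,
        subset_compl_comm, and_iff_right (subset_univ C')]
      refine and_congr_left fun _ => ?_
      rw [map_subset_iff_subset_preimage]
      simp [subset_iff]
    rw [this, card_powersetCard, card_compl, card_map, Fintype.card_fin]
  simp only [bipartiteBelow] at hdouble
  rw [sum_congr rfl fun σ _ => hleft σ, sum_congr rfl fun C' hC' => hinv C' hC'] at hdouble
  simp only [sum_const, card_univ, Fintype.card_perm, Fintype.card_fin, card_powersetCard,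
    smul_eq_mul] at hdouble
  rw [hdouble, mul_comm]

/-! ### The interpolated binomial ratios -/

/-- The ratio `C(K - i, m) / C(K, m)`, the probability that a random `m`-subset of `K` users
misses `i` given users. -/
noncomputable def binomRatio (K i m : ℕ) : ℝ := ((K - i).choose m : ℝ) / (K.choose m : ℝ)

/-- The line through the points `(m, a_m)` and `(m + 1, a_{m + 1})` for `a = binomRatio K i`. -/
noncomputable def ratioChord (K i m : ℕ) (x : ℝ) : ℝ :=
  binomRatio K i m + (x - m) * (binomRatio K i (m + 1) - binomRatio K i m)

/-- The symmetric form of the ratio, in which `m` occurs in the numerator only, so that differences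
in `m` follow from Pascal's rule. -/
theorem binomRatio_eq {K i : ℕ} (hi : 1 ≤ i) (hiK : i ≤ K) (m : ℕ) :
    binomRatio K i m = ((K - m).choose i : ℝ) / (K.choose i : ℝ) := by
  rcases le_or_gt m K with hm | hm
  · have h1 : (0 : ℝ) < K.choose m := by exact_mod_cast Nat.choose_pos hm
    have h2 : (0 : ℝ) < K.choose i := by exact_mod_cast Nat.choose_pos hiK
    rw [binomRatio, div_eq_div_iff h1.ne' h2.ne']
    rcases le_or_gt (i + m) K with him | him
    · have e := Nat.choose_mul (n := K) (k := i + m) (s := i) (by omega)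
      have e' := Nat.choose_mul (n := K) (k := i + m) (s := m) (by omega)
      have hs : (i + m).choose i = (i + m).choose m := by
        exact Nat.choose_symm_add
      rw [show i + m - i = m by omega] at e
      rw [show i + m - m = i by omega, ← hs] at e'
      have : (K - i).choose m * K.choose i = (K - m).choose i * K.choose m := by
        rw [mul_comm, ← e, e', mul_comm]
      exact_mod_cast this
    · rw [Nat.choose_eq_zero_of_lt (show K - i < m by omega),
        Nat.choose_eq_zero_of_lt (show K - m < i by omega)]
      simp
  · rw [binomRatio, Nat.choose_eq_zero_of_lt hm, Nat.sub_eq_zero_of_le hm.le,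
      Nat.choose_eq_zero_of_lt (show 0 < i by omega)]
    simp

theorem binomRatio_sub_succ {K i : ℕ} (hi : 1 ≤ i) (hiK : i ≤ K) {m : ℕ} :
    binomRatio K i m - binomRatio K i (m + 1) =
      if m < K then ((K - (m + 1)).choose (i - 1) : ℝ) / (K.choose i : ℝ) else 0 := by
  rw [binomRatio_eq hi hiK, binomRatio_eq hi hiK]
  split_ifs with hm
  · obtain ⟨i, rfl⟩ : ∃ j, i = j + 1 := ⟨i - 1, by omega⟩
    rw [← sub_div, show K - m = (K - (m + 1)) + 1 by omega, Nat.choose_succ_succ]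
    push_cast
    simp
  · rw [show K - m = 0 by omega, show K - (m + 1) = 0 by omega, sub_self]

theorem binomRatio_succ_le {K i : ℕ} (hi : 1 ≤ i) (hiK : i ≤ K) (m : ℕ) :
    binomRatio K i (m + 1) ≤ binomRatio K i m := by
  rw [← sub_nonneg, binomRatio_sub_succ hi hiK]
  split_ifs <;> positivity

theorem binomRatio_sub_succ_antitone {K i : ℕ} (hi : 1 ≤ i) (hiK : i ≤ K) :
    Antitone fun m => binomRatio K i m - binomRatio K i (m + 1) := by
  intro m m' hmm'
  simp only [binomRatio_sub_succ hi hiK]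
  split_ifs with h' h
  · have := Nat.choose_le_choose (i - 1) (show K - (m' + 1) ≤ K - (m + 1) by omega)
    gcongr
  · omega
  · positivity
  · exact le_rfl

/-- The sequence `binomRatio K i` is convex, so it lies above every line through two of its
consecutive points. -/
theorem ratioChord_natCast_le {K i : ℕ} (hi : 1 ≤ i) (hiK : i ≤ K) (m k : ℕ) :
    ratioChord K i m k ≤ binomRatio K i k := by
  have hanti := binomRatio_sub_succ_antitone hi hiK
  rcases le_total m k with hmk | hkm
  · induction k, hmk using Nat.le_induction with
    | base => simp [ratioChord]
    | succ k hmk ih =>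
      have h := hanti hmk
      simp only [ratioChord] at h ih ⊢
      push_cast
      linarith
  · induction hkm using Nat.decreasingInduction with
    | self => simp [ratioChord]
    | of_succ k hk ih =>
      have h := hanti (show k ≤ m by omega)
      simp only [ratioChord] at h ih ⊢
      push_cast at ih
      linarith

theorem interpolatedRatio_eq_ratioChord (K i : ℕ) (x : ℝ) :
    interpolatedRatio K i x = ratioChord K i ⌊x⌋₊ x := by
  simp only [interpolatedRatio, ratioChord, binomRatio]
  ring

theorem ratioChord_antitone {K i : ℕ} (hi : 1 ≤ i) (hiK : i ≤ K) (m : ℕ) :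
    Antitone (ratioChord K i m) := by
  intro x y hxy
  have := binomRatio_succ_le hi hiK m
  simp only [ratioChord]
  nlinarith

theorem ratioChord_le_interpolatedRatio {K i : ℕ} (hi : 1 ≤ i) (hiK : i ≤ K) (m : ℕ) {x : ℝ}
    (hx : 0 ≤ x) : ratioChord K i m x ≤ interpolatedRatio K i x := by
  have h0 := ratioChord_natCast_le hi hiK m ⌊x⌋₊
  have h1 := ratioChord_natCast_le hi hiK m (⌊x⌋₊ + 1)
  have hl := Nat.floor_le hx
  have hu := (Nat.lt_floor_add_one x).le
  rw [interpolatedRatio_eq_ratioChord]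
  -- `x` is a convex combination of `⌊x⌋₊` and `⌊x⌋₊ + 1`
  have e0 := mul_le_mul_of_nonneg_left h0 (show (0 : ℝ) ≤ 1 - (x - ⌊x⌋₊) by linarith)
  have e1 := mul_le_mul_of_nonneg_left h1 (sub_nonneg.2 hl)
  simp only [ratioChord] at e0 e1 ⊢
  push_cast at e1
  linarith

theorem interpolatedRatio_antitoneOn {K i : ℕ} (hi : 1 ≤ i) (hiK : i ≤ K) :
    AntitoneOn (interpolatedRatio K i) (Set.Ici 0) := by
  intro x hx y _ hxy
  rw [interpolatedRatio_eq_ratioChord K i y]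
  exact (ratioChord_antitone hi hiK _ hxy).trans (ratioChord_le_interpolatedRatio hi hiK _ hx)

/-- On `[0, K]` the interpolation is a maximum of finitely many lines. -/
theorem continuousOn_interpolatedRatio {K i : ℕ} (hi : 1 ≤ i) (hiK : i ≤ K) :
    ContinuousOn (interpolatedRatio K i) (Set.Icc 0 K) := by
  have hcont : ContinuousOn
      (fun x => (range (K + 1)).sup' ⟨0, by simp⟩ fun m => ratioChord K i m x)
      (Set.Icc (0 : ℝ) K) := by
    refine ContinuousOn.finset_sup'_apply _ fun m _ => ?_
    unfold ratioChord
    fun_prop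
  refine hcont.congr fun x hx => le_antisymm ?_ ?_
  · rw [interpolatedRatio_eq_ratioChord]
    refine le_sup' (fun m => ratioChord K i m x) (mem_range.2 (Nat.lt_succ_of_le ?_))
    exact Nat.floor_le_of_le hx.2
  · exact sup'_le _ _ fun m _ => ratioChord_le_interpolatedRatio hi hiK m hx.1

/-- Jensen's inequality for the interpolation of the convex sequence `binomRatio K i`. -/
theorem card_mul_interpolatedRatio_le_sum {K i F : ℕ} (hi : 1 ≤ i) (hiK : i ≤ K) (hF : 0 < F)
    (m : Fin F → ℕ) :
    F * interpolatedRatio K i ((∑ j, (m j : ℝ)) / F) ≤ ∑ j, binomRatio K i (m j) := by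
  set x := (∑ j, (m j : ℝ)) / F with hx
  have hF' : (F : ℝ) ≠ 0 := by positivity
  have hsum : ∑ j, (m j : ℝ) = F * x := by rw [hx]; field_simp
  rw [interpolatedRatio_eq_ratioChord]
  calc F * ratioChord K i ⌊x⌋₊ x = ∑ j, ratioChord K i ⌊x⌋₊ (m j) := by
        simp only [ratioChord, sum_add_distrib, ← sum_mul, sum_sub_distrib, hsum, sum_const,
          card_univ, Fintype.card_fin, nsmul_eq_mul]
        ring
    _ ≤ _ := sum_le_sum fun j _ => ratioChord_natCast_le hi hiK _ _

/-! ### The bound for a fixed file size -/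

/-- The number of symbols of file `n` that the caches hold in total, counted with multiplicity and
normalized by the file size `F`. -/
noncomputable def allocation {N K F : ℕ} (A : Placement N K F) (n : Fin N) : ℝ :=
  (∑ k, ((A k n).card : ℝ)) / F

theorem allocation_nonneg {N K F : ℕ} (A : Placement N K F) (n : Fin N) : 0 ≤ allocation A n := by
  unfold allocation
  positivity

theorem allocation_le {N K F : ℕ} (A : Placement N K F) (hF : 0 < F) (n : Fin N) :
    allocation A n ≤ K := by
  rw [allocation, div_le_iff₀ (by exact_mod_cast hF)]
  calc ∑ k, ((A k n).card : ℝ) ≤ ∑ _k : Fin K, (F : ℝ) :=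
        sum_le_sum fun k _ => by exact_mod_cast card_finset_fin_le (A k n)
    _ = K * F := by simp

theorem sum_allocation_le {Ω 𝔽 : Type*} [MeasurableSpace Ω] [Fintype 𝔽]
    [Nontrivial 𝔽] [MeasurableSpace 𝔽] [MeasurableSingletonClass 𝔽] {N K F : ℕ}
    (μ : Measure Ω) [IsProbabilityMeasure μ] {W : (F : ℕ) → Fin N → Ω → File 𝔽 F}
    (hW : IsUniformLibrary μ W) (A : Placement N K F) {M : ℝ} (hA : FitsMemory μ (W F) A M)
    (hF : 0 < F) : ∑ n, allocation A n ≤ M * K := by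
  have hk : ∀ k, ∑ n, ((A k n).card : ℝ) ≤ M * F := by
    intro k
    have h := natCast_le_of_le_of_coe_le (sum_card_le_entropy_cacheContent μ hW A k) (hA k)
    exact_mod_cast h
  simp only [allocation]
  rw [← sum_div, div_le_iff₀ (by exact_mod_cast hF), sum_comm]
  calc ∑ k, ∑ n, ((A k n).card : ℝ) ≤ ∑ _k : Fin K, M * F := sum_le_sum fun k _ => hk k
    _ = M * K * F := by
      rw [sum_const, card_univ, Fintype.card_fin, nsmul_eq_mul]
      ring

/-- A lower bound for the number of symbols of file `n` missed by all of `u 0, …, u i`, summed over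
all permutations of the users: a symbol stored by `m` users contributes
`K! * C(K - (i + 1), m) / C(K, m)`, and Jensen's inequality applies to the sum over the symbols. -/
theorem factorial_mul_interpolatedRatio_le {N K F s : ℕ} (A : Placement N K F) (hF : 0 < F)
    (n : Fin N) (u : Fin s → Fin K) (hu : u.Injective) (i : Fin s) :
    K.factorial * (F * interpolatedRatio K (i + 1) (allocation A n)) ≤
      ∑ σ : Equiv.Perm (Fin K), (#{j : Fin F | ∀ i' ≤ i, j ∉ A (σ (u i')) n} : ℝ) := by
  classical
  have hsK : s ≤ K := by simpa using Fintype.card_le_of_injective u hu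
  have hiK : (i : ℕ) + 1 ≤ K := by omega
  let C : Fin F → Finset (Fin K) := fun j => {k | j ∈ A k n}
  let U : Finset (Fin K) := (Iic i).image u
  have hU : U.card = i + 1 := by simp [U, card_image_of_injective _ hu]
  have hcount : ∀ j, (#{σ : Equiv.Perm (Fin K) | ∀ x ∈ U, σ x ∉ C j} : ℝ) =
      K.factorial * binomRatio K (i + 1) (C j).card := by
    intro j
    have h := card_perm_avoiding_mul_choose U (C j)
    have hpos : (0 : ℝ) < K.choose (C j).card := by
      exact_mod_cast Nat.choose_pos (card_finset_fin_le (C j))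
    rw [binomRatio, ← mul_div_assoc, eq_div_iff hpos.ne', ← hU]
    exact_mod_cast h
  have hC : ∑ j, ((C j).card : ℝ) = ∑ k, ((A k n).card : ℝ) := by
    have h := sum_card_bipartiteAbove_eq_sum_card_bipartiteBelow (s := (univ : Finset (Fin F)))
      (t := (univ : Finset (Fin K))) (fun j k => j ∈ A k n)
    simp only [bipartiteAbove, bipartiteBelow, filter_univ_mem] at h
    exact_mod_cast h
  have hswap := sum_card_bipartiteAbove_eq_sum_card_bipartiteBelow
    (s := (univ : Finset (Equiv.Perm (Fin K)))) (t := (univ : Finset (Fin F)))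
    (fun σ j => ∀ i' ≤ i, j ∉ A (σ (u i')) n)
  simp only [bipartiteAbove, bipartiteBelow] at hswap
  have hjensen := card_mul_interpolatedRatio_le_sum (K := K) (i := i + 1) (by omega) hiK hF
    fun j => (C j).card
  rw [hC] at hjensen
  calc K.factorial * (F * interpolatedRatio K (i + 1) (allocation A n))
      ≤ K.factorial * ∑ j, binomRatio K (i + 1) (C j).card := by
        gcongr
        exact hjensen
    _ = ∑ j, (#{σ : Equiv.Perm (Fin K) | ∀ x ∈ U, σ x ∉ C j} : ℝ) := by
        rw [mul_sum]
        exact sum_congr rfl fun j _ => (hcount j).symm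
    _ = ∑ j, (#{σ : Equiv.Perm (Fin K) | ∀ i' ≤ i, j ∉ A (σ (u i')) n} : ℝ) := by
        simp [U, C]
    _ = _ := by exact_mod_cast hswap.symm

/-- Averaging the cut-set bound over all permutations of the users gives `R_π(t, S)`. -/
theorem factorial_mul_orderingRate_le {Ω 𝔽 : Type*} [MeasurableSpace Ω] [Fintype 𝔽]
    [Nontrivial 𝔽] [MeasurableSpace 𝔽] [MeasurableSingletonClass 𝔽] {N K F : ℕ}
    (μ : Measure Ω) [IsProbabilityMeasure μ] {W : (F : ℕ) → Fin N → Ω → File 𝔽 F}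
    (hW : IsUniformLibrary μ W) (A : Placement N K F) (R : (Fin K → Fin N) → ℝ)
    (hR : ∀ d, DeliveryRateAchievable μ (W F) A d (R d)) (hF : 0 < F) (d : Fin K → Fin N)
    (π : Fin (univ.image d).card ≃ univ.image d) :
    K.factorial * orderingRate K (allocation A) (univ.image d) π ≤
      ∑ σ : Equiv.Perm (Fin K), R (d ∘ σ.symm) := by
  have hex : ∀ i, ∃ k, d k = π i := fun i => by
    obtain ⟨k, -, hk⟩ := mem_image.1 (π i).2
    exact ⟨k, hk⟩
  choose u hu using hex
  have hπ : Function.Injective fun i => (π i : Fin N) := Subtype.val_injective.comp π.injective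
  have hu_inj : u.Injective := fun i i' h => hπ (by
    change (π i : Fin N) = π i'
    rw [← hu i, ← hu i', h])
  have hcut : ∀ σ : Equiv.Perm (Fin K),
      ∑ i, (#{j : Fin F | ∀ i' ≤ i, j ∉ A (σ (u i')) (π i)} : ℝ) ≤ R (d ∘ σ.symm) * F := by
    intro σ
    have h := sum_card_uncached_le_of_deliveryRateAchievable μ hW A (d ∘ σ.symm) _
      (hR (d ∘ σ.symm)) (fun i => (π i : Fin N)) hπ (fun i => σ (u i)) (by simpa using hu)
    exact_mod_cast h
  have hF' : (0 : ℝ) < F := by exact_mod_cast hF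
  rw [← mul_le_mul_iff_left₀ hF', sum_mul]
  calc K.factorial * orderingRate K (allocation A) (univ.image d) π * F
      = ∑ i : Fin (univ.image d).card,
          K.factorial * (F * interpolatedRatio K (i + 1) (allocation A (π i))) := by
        rw [orderingRate, mul_assoc, sum_mul, mul_sum]
        exact sum_congr rfl fun i _ => by ring
    _ ≤ ∑ i, ∑ σ : Equiv.Perm (Fin K), (#{j : Fin F | ∀ i' ≤ i, j ∉ A (σ (u i')) (π i)} : ℝ) :=
        sum_le_sum fun i _ => factorial_mul_interpolatedRatio_le A hF _ u hu_inj i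
    _ ≤ _ := by
        rw [sum_comm]
        exact sum_le_sum fun σ _ => hcut σ

theorem converseBound_eq_sum {N : ℕ} (K : ℕ) (p t : Fin N → ℝ) :
    converseBound K p t =
      ∑ d : Fin K → Fin N, (∏ k, p (d k)) * maxOrderingRate K t (univ.image d) := by
  rw [converseBound, ← sum_fiberwise univ fun d : Fin K → Fin N => univ.image d]
  refine sum_congr rfl fun S _ => sum_congr rfl fun d hd => ?_
  rw [(mem_filter.1 hd).2]

theorem converseBound_allocation_le_expectedRate {Ω 𝔽 : Type*} [MeasurableSpace Ω] [Fintype 𝔽]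
    [Nontrivial 𝔽] [MeasurableSpace 𝔽] [MeasurableSingletonClass 𝔽] {N K F : ℕ}
    (μ : Measure Ω) [IsProbabilityMeasure μ] {W : (F : ℕ) → Fin N → Ω → File 𝔽 F}
    (hW : IsUniformLibrary μ W) (A : Placement N K F) (R : (Fin K → Fin N) → ℝ)
    (hR : ∀ d, DeliveryRateAchievable μ (W F) A d (R d)) (hF : 0 < F)
    {p : Fin N → ℝ} (hp : ∀ n, 0 ≤ p n) :
    converseBound K p (allocation A) ≤ expectedRate p R := by
  have hfact : (0 : ℝ) < K.factorial := by exact_mod_cast K.factorial_pos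
  have hmax : ∀ d : Fin K → Fin N, K.factorial * maxOrderingRate K (allocation A) (univ.image d) ≤
      ∑ σ : Equiv.Perm (Fin K), R (d ∘ σ.symm) := by
    intro d
    rw [← le_div_iff₀' hfact]
    refine sup'_le _ _ fun π _ => ?_
    rw [le_div_iff₀' hfact]
    exact factorial_mul_orderingRate_le μ hW A R hR hF d π
  -- the law of the request vector is invariant under permutations of the users
  have hinv : ∀ σ : Equiv.Perm (Fin K),
      ∑ d : Fin K → Fin N, (∏ k, p (d k)) * R (d ∘ σ.symm) = expectedRate p R := by
    intro σ
    refine Fintype.sum_equiv (σ.arrowCongr (Equiv.refl (Fin N))) _ _ fun d => ?_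
    congr 1
    exact (Equiv.prod_comp σ.symm fun k => p (d k)).symm
  rw [← mul_le_mul_iff_right₀ hfact, converseBound_eq_sum]
  calc (K.factorial : ℝ) *
        ∑ d : Fin K → Fin N, (∏ k, p (d k)) * maxOrderingRate K (allocation A) (univ.image d)
      = ∑ d : Fin K → Fin N,
          (∏ k, p (d k)) * (K.factorial * maxOrderingRate K (allocation A) (univ.image d)) := by
        rw [mul_sum]
        exact sum_congr rfl fun d _ => by ring
    _ ≤ ∑ d : Fin K → Fin N, (∏ k, p (d k)) * ∑ σ : Equiv.Perm (Fin K), R (d ∘ σ.symm) :=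
        sum_le_sum fun d _ =>
          mul_le_mul_of_nonneg_left (hmax d) (prod_nonneg fun k _ => hp (d k))
    _ = ∑ σ : Equiv.Perm (Fin K), ∑ d : Fin K → Fin N, (∏ k, p (d k)) * R (d ∘ σ.symm) := by
        simp_rw [mul_sum]
        exact sum_comm
    _ = K.factorial * expectedRate p R := by
        simp [hinv, Fintype.card_perm]

/-! ### Minimization over the cache allocations -/

theorem card_image_le_users {N K : ℕ} (d : Fin K → Fin N) : (univ.image d).card ≤ K := by
  simpa using card_image_le (s := univ) (f := d)

theorem converseBound_anti {N K : ℕ} {p : Fin N → ℝ} (hp : ∀ n, 0 ≤ p n) {t t' : Fin N → ℝ}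
    (ht : ∀ n, 0 ≤ t n) (htt' : ∀ n, t n ≤ t' n) :
    converseBound K p t' ≤ converseBound K p t := by
  rw [converseBound_eq_sum, converseBound_eq_sum]
  refine sum_le_sum fun d _ => mul_le_mul_of_nonneg_left ?_ (prod_nonneg fun k _ => hp (d k))
  have hd := card_image_le_users d
  refine sup'_mono_fun fun π _ => sum_le_sum fun i _ => ?_
  exact interpolatedRatio_antitoneOn (by omega) (by omega) (ht _) ((ht _).trans (htt' _)) (htt' _)

theorem continuousOn_converseBound {N : ℕ} (K : ℕ) (p : Fin N → ℝ) (M : ℝ) :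
    ContinuousOn (converseBound K p) (cacheAllocations N K M) := by
  simp only [funext (converseBound_eq_sum K p)]
  refine continuousOn_finsetSum _ fun d _ => continuousOn_const.mul ?_
  have hd := card_image_le_users d
  refine ContinuousOn.finset_sup'_apply _ fun π _ => ?_
  refine continuousOn_finsetSum _ fun i _ => ?_
  exact (continuousOn_interpolatedRatio (by omega) (by omega)).comp
    (continuous_apply _).continuousOn fun t ht => ht.2 _

theorem isCompact_cacheAllocations (N K : ℕ) (M : ℝ) : IsCompact (cacheAllocations N K M) := by
  have h : cacheAllocations N K M =
      (Set.univ.pi fun _ => Set.Icc (0 : ℝ) K) ∩ {t | ∑ n, t n = M * K} := by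
    ext t
    simp only [cacheAllocations, Set.mem_inter_iff, Set.mem_univ_pi, Set.mem_Icc,
      Set.mem_ofPred_eq, and_comm]
  rw [h]
  refine (isCompact_univ_pi fun _ => isCompact_Icc).inter_right ?_
  exact isClosed_eq (by fun_prop) continuous_const

/-- Unused memory can be filled: an allocation of at most the total memory lies below one that
uses all of it. -/
theorem exists_mem_cacheAllocations_ge {N K : ℕ} {M : ℝ} (hM : M ≤ N) {t : Fin N → ℝ}
    (ht : ∀ n, 0 ≤ t n) (htK : ∀ n, t n ≤ K) (hsum : ∑ n, t n ≤ M * K) :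
    ∃ t' ∈ cacheAllocations N K M, ∀ n, t n ≤ t' n := by
  have hMK : M * K ≤ N * K := by gcongr
  -- moves `t` towards the full allocation `(K, …, K)`; the ratio is `0` if `t` is already full
  set c : ℝ := (M * K - ∑ n, t n) / (N * K - ∑ n, t n) with hc
  have hc0 : 0 ≤ c := div_nonneg (by linarith) (by linarith)
  have hc1 : c ≤ 1 := div_le_one_of_le₀ (by linarith) (by linarith)
  have hcmul : c * (N * K - ∑ n, t n) = M * K - ∑ n, t n :=
    div_mul_cancel_of_imp fun h => by linarith
  have hle : ∀ n, t n ≤ t n + c * (K - t n) := fun n =>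
    le_add_of_nonneg_right (mul_nonneg hc0 (sub_nonneg.2 (htK n)))
  refine ⟨fun n => t n + c * (K - t n), ⟨?_, fun n => ⟨(ht n).trans (hle n), ?_⟩⟩, hle⟩
  · rw [sum_add_distrib, ← mul_sum, sum_sub_distrib, sum_const, card_univ, Fintype.card_fin,
      nsmul_eq_mul, hcmul]
    ring
  · have := mul_le_mul_of_nonneg_right hc1 (sub_nonneg.2 (htK n))
    linarith

end CodedCaching

theorem mainTheorem2 {Ω 𝔽 : Type*} [MeasurableSpace Ω] [Field 𝔽] [Fintype 𝔽]
    [MeasurableSpace 𝔽] [MeasurableSingletonClass 𝔽]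
    (μ : Measure Ω) [IsProbabilityMeasure μ] {N : ℕ}
    (W : (F : ℕ) → Fin N → Ω → CodedCaching.File 𝔽 F)
    (hW : CodedCaching.IsUniformLibrary μ W)
    (p : Fin N → ℝ) (hp_nonneg : ∀ n, 0 ≤ p n) (hp_sum : ∑ n, p n = 1)
    (K : ℕ) (M : ℝ) (hM_nonneg : 0 ≤ M) (hM_le : M ≤ N) :
    ∃ b : ℝ,
      IsLeast (CodedCaching.converseBound K p '' CodedCaching.cacheAllocations N K M) b ∧
      ∀ Rbar : ℝ, CodedCaching.ExpectedRateAchievable μ W p K M Rbar → b ≤ Rbar := by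
  have hne : (CodedCaching.cacheAllocations N K M).Nonempty := by
    obtain ⟨t, ht, -⟩ := CodedCaching.exists_mem_cacheAllocations_ge (K := K) hM_le
      (t := fun _ => 0) (fun _ => le_rfl) (fun _ => Nat.cast_nonneg K)
      (by simpa using mul_nonneg hM_nonneg (Nat.cast_nonneg K))
    exact ⟨t, ht⟩
  obtain ⟨t₀, ht₀, hmin⟩ := (CodedCaching.isCompact_cacheAllocations N K M).exists_isMinOn hne
    (CodedCaching.continuousOn_converseBound K p M)
  refine ⟨CodedCaching.converseBound K p t₀, ⟨⟨t₀, ht₀, rfl⟩, ?_⟩, ?_⟩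
  · rintro _ ⟨t, ht, rfl⟩
    exact hmin ht
  rintro Rbar ⟨A, hA, R', hR', R, hR, hlim⟩
  have hbound : ∀ F, 0 < F →
      CodedCaching.converseBound K p t₀ ≤ CodedCaching.expectedRate p (R F) := by
    intro F hF
    obtain ⟨t, ht, hle⟩ := CodedCaching.exists_mem_cacheAllocations_ge hM_le
      (CodedCaching.allocation_nonneg (A F)) (CodedCaching.allocation_le (A F) hF)
      (CodedCaching.sum_allocation_le μ hW (A F) (hA F) hF)
    calc CodedCaching.converseBound K p t₀ ≤ CodedCaching.converseBound K p t := hmin ht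
      _ ≤ CodedCaching.converseBound K p (CodedCaching.allocation (A F)) :=
        CodedCaching.converseBound_anti hp_nonneg (CodedCaching.allocation_nonneg (A F)) hle
      _ ≤ _ := CodedCaching.converseBound_allocation_le_expectedRate μ hW (A F) (R F) (hR F) hF
        hp_nonneg
  have hlimsup : ((CodedCaching.converseBound K p t₀ : ℝ) : EReal) ≤
      limsup (fun F : ℕ => ((CodedCaching.expectedRate p (R F) : ℝ) : EReal)) atTop := by
    refine le_limsup_of_frequently_le' (Eventually.frequently ?_)
    filter_upwards [eventually_gt_atTop 0] with F hF
    exact EReal.coe_le_coe_iff.2 (hbound F hF)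
  exact (EReal.coe_le_coe_iff.1 (hlimsup.trans hlim)).trans hR'
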